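/- For a real sequence $(x_m)_{m\ge 1}$ let $B(n,k)=B_{n,k}(x_1,x_2,\dots)$ denote the exponential partial Bell polynomials, defined by $\sum_{n\ge k}B_{n,k}(x_1,x_2,\dots)\frac{t^n}{n!}=\frac1{k!}\bigl(\sum_{m\ge1}x_m\frac{t^m}{m!}\bigr)^k$, and let $A_0=1$, $A_n=\sum_{k=1}^nB_{n,k}$ $(n\ge1)$ be the complete Bell polynomials. A sequence of real polynomials $(f_n)_{n\ge0}$ with $f_0=1$ and $\deg f_n=n$ is of binomial type if $f_n(u+v)=\sum_{k=0}^n\binom nk f_k(u)f_{n-k}(v)$ for all $n\ge 0$ and all real $u,v$. We say that $Z(n,s)$ satisfies (b) if $$A_n\bigl(sZ(1,0),sZ(2,0),\dots,sZ(n,0)\bigr)=sZ(n,s)\qquad\text{for all integers } n\ge1,\ s\ge0.$$ Let $(x_m)_{m\ge1}$ be a real sequence with $x_1\ne0$. Then there is a sequence $(f_n)$ of binomial type with $Df_n(0)=x_n$ for all $n\ge1$. Moreover, for every such $(f_n)$, every integer $r\ge1$ and all real $b,c,x$, with $R=R(n,s)=nr+s$: 1. the sequence $$Z(n,s)=\frac1{(Df_1(0))^s}\,\frac1R\binom{R+n}{n}^{-1}\sum_{j=0}^n\binom{R+j-1}{R-1}B(R+n,R+j)\,(cn+bs)^{j-1}\bigl\{((r+1)b-c)j+cn+bs\bigr\}$$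 satisfies (b), where for $j=0$ the factor $(cn+bs)^{-1}\{cn+bs\}$ is read as $1$ (also if $cn+bs=0$), and $0^0=1$; 2. in particular, the sequence $$Z(n,s)=\frac1{(Df_1(0))^s}\,\frac1R\binom{R+n}{n}^{-1}\sum_{j=0}^n\binom{R+j-1}{R-1}B(R+n,R+j)\,(R+n)^jx^j$$ satisfies (b), with $0^0=1$. -/

import Mathlib

open Finset

noncomputable section

/-- The exponential generating function `∑_{m ≥ 1} x_m t^m / m!` of a real sequence
`(x_m)_{m ≥ 1}`; the value `x 0` is not used. -/
def expGen (x : ℕ → ℝ) : PowerSeries ℝ :=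
  PowerSeries.mk fun m => if m = 0 then 0 else x m / (m.factorial : ℝ)

/-- The value `B_{n,k}(x_1, x_2, …)` of the (exponential) partial Bell polynomial, defined by
`∑_n B_{n,k}(x_1, x_2, …) t^n / n! = (1 / k!) (∑_{m ≥ 1} x_m t^m / m!)^k`. -/
def partialBell (n k : ℕ) (x : ℕ → ℝ) : ℝ :=
  (n.factorial : ℝ) * ((1 / (k.factorial : ℝ)) * PowerSeries.coeff n (expGen x ^ k))

/-- The value `A_n(x_1, x_2, …)` of the (exponential) complete Bell polynomial:
`A_0 = 1` and `A_n = ∑_{k=1}^n B_{n,k}` for `n ≥ 1`. -/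
def completeBell (n : ℕ) (x : ℕ → ℝ) : ℝ :=
  if n = 0 then 1 else ∑ k ∈ Icc 1 n, partialBell n k x

/-- A sequence of real polynomials `f_n` of degree `n` with `f_0 = 1` is of binomial type if
`f_n(u + v) = ∑_{k=0}^n C(n,k) f_k(u) f_{n-k}(v)`. -/
structure IsBinomialType (f : ℕ → Polynomial ℝ) : Prop where
  zero : f 0 = 1
  natDegree_eq : ∀ n, (f n).natDegree = n
  eval_add : ∀ (n : ℕ) (u v : ℝ), (f n).eval (u + v) =
    ∑ k ∈ range (n + 1), (n.choose k : ℝ) * (f k).eval u * (f (n - k)).eval v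

/-- The system of equations
`A_n(s Z(1,0), s Z(2,0), …, s Z(n,0)) = s Z(n,s)` for all `n ≥ 1` and `s ≥ 0`. -/
def SatisfiesCompleteBellEq (Z : ℕ → ℕ → ℝ) : Prop :=
  ∀ n s : ℕ, 1 ≤ n → completeBell n (fun m => (s : ℝ) * Z m 0) = (s : ℝ) * Z n s

/-- The two-parameter sequence `Z(n,s)`, with `d` in the role of `Df_1(0)` and `R = n r + s`.
The `j = 0` factor `(cn+bs)^{-1} (cn+bs)` is `1`, also where `cn+bs` vanishes. -/
def bellZ (x : ℕ → ℝ) (d : ℝ) (r : ℕ) (b c : ℝ) (n s : ℕ) : ℝ :=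
  let R : ℕ := n * r + s
  let w : ℝ := c * n + b * s
  1 / d ^ s * (1 / (R : ℝ)) * ((R + n).choose n : ℝ)⁻¹ *
    ∑ j ∈ range (n + 1), ((R + j - 1).choose (R - 1) : ℝ) * partialBell (R + n) (R + j) x *
      (if j = 0 then 1 else w ^ (j - 1) * ((((r : ℝ) + 1) * b - c) * j + w))

/-- The one-parameter sequence `Z(n,s)`, with `d` in the role of `Df_1(0)` and `R = n r + s`. -/
def bellZPow (x : ℕ → ℝ) (d : ℝ) (r : ℕ) (y : ℝ) (n s : ℕ) : ℝ :=
  let R : ℕ := n * r + s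
  1 / d ^ s * (1 / (R : ℝ)) * ((R + n).choose n : ℝ)⁻¹ *
    ∑ j ∈ range (n + 1), ((R + j - 1).choose (R - 1) : ℝ) * partialBell (R + n) (R + j) x *
      ((R + n : ℕ) : ℝ) ^ j * y ^ j

end

/-! Write φ for `expGen x`, P = φ/X, F = e^{bφ} P and V = e^{cφ} P^r. Expanding e^{(cn+bs)φ} shows
that the intricate sum is Z(n,s) = F(0)^{-s} (n-1)! [X^{n-1}] F^s (F'/F) V^n (`bellZ_eq_coeff`). By
Lagrange inversion, n [X^n] Y = [X^{n-1}] Y(X/V)' V^n for every series Y. Let S be the compositional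
inverse of X/V and ℓ = log(F/F(0)) ∘ S. Taking Y = ℓ identifies ℓ as the exponential generating
function of Z(n,0); taking Y = exp(sℓ) = (F/F(0))^s ∘ S yields s Z(n,s). Since exp(sℓ) generates the
complete Bell polynomials at s Z(m,0), this is the claim (`completeBell_lagrange`). The second
family is the case b = y, c = (r+1)y. Existence of f comes from f_n(u) = n! [X^n] e^{uφ}. -/

/-! ### Lagrange inversion and exponentiation. -/

open PowerSeries in
/-- Lagrange inversion: the coefficients of `W(T) T' V^{n+1}` with `T = X / V`. -/
theorem coeff_subst_mul_derivative_mul_pow {V : PowerSeries ℝ} (hV : constantCoeff V ≠ 0)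
    (n : ℕ) (W : PowerSeries ℝ) :
    coeff n (W.subst (X * V⁻¹) * d⁄dX ℝ (X * V⁻¹) * V ^ (n + 1)) = coeff n W := by
  have hT : HasSubst (X * V⁻¹ : PowerSeries ℝ) := HasSubst.of_constantCoeff_zero' (by simp)
  have hVi : V * V⁻¹ = 1 := PowerSeries.mul_inv_cancel V hV
  have hdT : d⁄dX ℝ (X * V⁻¹) = V⁻¹ - X * (V⁻¹ ^ 2 * d⁄dX ℝ V) := by
    rw [Derivation.leibniz]
    simp only [smul_eq_mul, derivative_inv', derivative_X]
    ring
  have hsplit (W : PowerSeries ℝ) :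
      W.subst (X * V⁻¹) = C (constantCoeff W) +
        X * V⁻¹ * (mk fun p => coeff (p + 1) W).subst (X * V⁻¹) := by
    conv_lhs => rw [eq_X_mul_shift_add_const W]
    rw [subst_add hT, subst_mul hT, subst_X hT, subst_C]
    exact add_comm _ _
  -- With T = X/V, this is the residue of T'/T^{m+2}, which vanishes because that is a derivative of
  -- a Laurent series.
  have hres (m : ℕ) : coeff (m + 1) (d⁄dX ℝ (X * V⁻¹) * V ^ (m + 2)) = 0 := by
    have h1 : d⁄dX ℝ (X * V⁻¹) * V ^ (m + 2) = V ^ (m + 1) - X * (V ^ m * d⁄dX ℝ V) := by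
      rw [hdT]
      linear_combination (V ^ (m + 1) - X * V ^ m * d⁄dX ℝ V * (V * V⁻¹ + 1)) * hVi
    have h2 : coeff m (d⁄dX ℝ (V ^ (m + 1))) = ((m : ℝ) + 1) * coeff m (V ^ m * d⁄dX ℝ V) := by
      rw [PowerSeries.derivative_pow]
      have : ((m + 1 : ℕ) : PowerSeries ℝ) = C ((m : ℝ) + 1) := by simp
      rw [this, mul_assoc, coeff_C_mul, Nat.add_sub_cancel]
    rw [coeff_derivative, mul_comm] at h2
    rw [h1, map_sub, coeff_succ_X_mul, sub_eq_zero]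
    exact mul_left_cancel₀ (by positivity) h2
  induction n generalizing W with
  | zero =>
    have h0 : constantCoeff V * (constantCoeff V)⁻¹ = 1 := mul_inv_cancel₀ hV
    rw [hsplit, hdT]
    simp only [coeff_zero_eq_constantCoeff, map_mul, map_add, map_sub, map_pow,
      constantCoeff_C, constantCoeff_X, constantCoeff_inv]
    linear_combination (constantCoeff W) * h0
  | succ n ih =>
    -- Splitting off W(0) leaves a factor T, and T V = X lowers the index by one.
    have key : W.subst (X * V⁻¹) * d⁄dX ℝ (X * V⁻¹) * V ^ (n + 2) =
        C (constantCoeff W) * (d⁄dX ℝ (X * V⁻¹) * V ^ (n + 2)) +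
        X * ((mk fun p => coeff (p + 1) W).subst (X * V⁻¹) *
          d⁄dX ℝ (X * V⁻¹) * V ^ (n + 1)) := by
      rw [hsplit W]
      linear_combination (X * (mk fun p => coeff (p + 1) W).subst (X * V⁻¹) *
          d⁄dX ℝ (X * V⁻¹) * V ^ (n + 1)) * hVi
    rw [show n + 1 + 1 = n + 2 from rfl, key, map_add, coeff_C_mul, hres, coeff_succ_X_mul, ih,
      coeff_mk]
    ring

open PowerSeries in
/-- Lagrange inversion: the coefficients of `Y` in terms of `Y(X / V)`. -/
theorem coeff_succ_eq_coeff_derivative_subst {V : PowerSeries ℝ} (hV : constantCoeff V ≠ 0)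
    (n : ℕ) (Y : PowerSeries ℝ) :
    ((n : ℝ) + 1) * coeff (n + 1) Y =
      coeff n (d⁄dX ℝ (Y.subst (X * V⁻¹)) * V ^ (n + 1)) := by
  rw [derivative_subst (HasSubst.of_constantCoeff_zero' (by simp)),
    coeff_subst_mul_derivative_mul_pow hV, coeff_derivative, mul_comm]

open PowerSeries in
theorem coeff_pow_eq_zero_of_lt {φ : PowerSeries ℝ} (hφ : constantCoeff φ = 0) {n k : ℕ}
    (h : n < k) : coeff n (φ ^ k) = 0 :=
  coeff_of_lt_order _ <| (Nat.cast_lt.mpr h).trans_le <| le_order_pow_of_constantCoeff_eq_zero k hφ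

open PowerSeries in
theorem coeff_subst_eq_sum {φ : PowerSeries ℝ} (hφ : constantCoeff φ = 0) (G : PowerSeries ℝ)
    {n N : ℕ} (h : n ≤ N) :
    coeff n (G.subst φ) = ∑ k ∈ range (N + 1), coeff k G * coeff n (φ ^ k) := by
  rw [coeff_subst' (HasSubst.of_constantCoeff_zero' hφ)]
  refine finsum_eq_sum_of_support_subset _ fun k hk => ?_
  by_contra hk'
  simp only [coe_range, Set.mem_Iio, not_lt] at hk'
  exact hk (by simp [coeff_pow_eq_zero_of_lt hφ (show n < k by omega)])

open PowerSeries in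
theorem coeff_subst_mul_eq_sum {φ : PowerSeries ℝ} (hφ : constantCoeff φ = 0)
    (G H : PowerSeries ℝ) (n : ℕ) :
    coeff n (G.subst φ * H) = ∑ k ∈ range (n + 1), coeff k G * coeff n (φ ^ k * H) := by
  simp only [coeff_mul n, mul_sum]
  rw [sum_comm]
  refine sum_congr rfl fun p hp => ?_
  rw [coeff_subst_eq_sum hφ G (Nat.le.intro (mem_antidiagonal.mp hp)), sum_mul]
  exact sum_congr rfl fun k _ => mul_assoc _ _ _

open PowerSeries in
theorem constantCoeff_expGen (x : ℕ → ℝ) : constantCoeff (expGen x) = 0 := by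
  rw [← coeff_zero_eq_constantCoeff_apply, expGen, coeff_mk, if_pos rfl]

open PowerSeries in
theorem completeBell_eq_coeff_exp {n : ℕ} (hn : n ≠ 0) (x : ℕ → ℝ) :
    completeBell n x = (n.factorial : ℝ) * coeff n ((exp ℝ).subst (expGen x)) := by
  rw [completeBell, if_neg hn, coeff_subst_eq_sum (constantCoeff_expGen x) _ le_rfl,
    range_eq_Ico, sum_eq_sum_Ico_succ_bot (by omega), pow_zero, coeff_one, if_neg hn, mul_zero,
    zero_add, mul_sum]
  refine sum_congr rfl fun k _ => ?_
  simp [partialBell]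

open PowerSeries in
/-- Exponentiating the Lagrange inversion of a logarithm: `E = exp (s log F)` in the variable
`X / V`. -/
theorem completeBell_lagrange {F V : PowerSeries ℝ} (hF : constantCoeff F ≠ 0)
    (hV : constantCoeff V ≠ 0) (s n : ℕ) {z : ℕ → ℝ}
    (hz : ∀ m, z (m + 1) = (m.factorial : ℝ) * coeff m (d⁄dX ℝ F * F⁻¹ * V ^ (m + 1))) :
    completeBell (n + 1) (fun m => (s : ℝ) * z m) =
      (s : ℝ) * ((constantCoeff F)⁻¹ ^ s * ((n.factorial : ℝ) *
        coeff n (F ^ s * d⁄dX ℝ F * F⁻¹ * V ^ (n + 1)))) := by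
  set T : PowerSeries ℝ := X * V⁻¹ with hTdef
  have hT0 : constantCoeff T = 0 := by simp [T]
  have hT : HasSubst T := HasSubst.of_constantCoeff_zero' hT0
  have hT1 : IsUnit (coeff 1 T) := by
    rw [hTdef, ← zero_add 1, coeff_succ_X_mul]
    simpa using hV
  set S := T.substInvOfIsUnit hT1
  have hS : HasSubst S := HasSubst.substInvOfIsUnit T hT1
  have hS0 : constantCoeff S = 0 := constantCoeff_substInvOfIsUnit T hT1
  obtain ⟨L, hL, hL0⟩ : ∃ L : PowerSeries ℝ, d⁄dX ℝ L = d⁄dX ℝ F * F⁻¹ ∧ constantCoeff L = 0 := by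
    -- L = log(F/F(0)) by termwise integration; at m = 0 the convention 0⁻¹ = 0 gives the zero
    -- constant term.
    refine ⟨mk fun m => coeff (m - 1) (d⁄dX ℝ F * F⁻¹) * (m : ℝ)⁻¹, ?_, ?_⟩
    · ext m
      rw [coeff_derivative, coeff_mk, Nat.add_sub_cancel]
      push_cast
      rw [mul_assoc, inv_mul_cancel₀ (by positivity), mul_one]
    · rw [← coeff_zero_eq_constantCoeff_apply, coeff_mk]
      simp
  set ℓ : PowerSeries ℝ := L.subst S with hℓ
  have hℓ0 : constantCoeff ℓ = 0 := constantCoeff_subst_eq_zero hS0 L hL0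
  have hℓT : ℓ.subst T = L := by
    rw [hℓ, subst_comp_subst_apply hS hT]
    have : PowerSeries.subst T S = X := subst_substInvOfIsUnit_left T hT0 hT1
    rw [this, ← map_algebraMap_eq_subst_X]
    simp
  have hgen : expGen (fun m => (s : ℝ) * z m) = (s : ℝ) • ℓ := by
    ext m
    rw [expGen, coeff_mk, coeff_smul]
    rcases m with _ | m
    · simp [hℓ0]
    · have h := coeff_succ_eq_coeff_derivative_subst hV m ℓ
      rw [hℓT, hL] at h
      rw [if_neg (Nat.succ_ne_zero m), hz, ← h, Nat.factorial_succ, smul_eq_mul]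
      have : (m.factorial : ℝ) ≠ 0 := by positivity
      push_cast
      field_simp
  have hsℓ : HasSubst ((s : ℝ) • ℓ) := HasSubst.of_constantCoeff_zero' (by simp [hℓ0])
  have hsL : HasSubst ((s : ℝ) • L) := HasSubst.of_constantCoeff_zero' (by simp [hL0])
  set Y : PowerSeries ℝ := (exp ℝ).subst ((s : ℝ) • L) with hYdef
  have hYT : PowerSeries.subst T ((exp ℝ).subst ((s : ℝ) • ℓ) : PowerSeries ℝ) = Y := by
    rw [subst_comp_subst_apply hsℓ hT, subst_smul hT, hℓT]
  have hFi : F * F⁻¹ = 1 := PowerSeries.mul_inv_cancel F hF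
  have hdY : d⁄dX ℝ Y = (s : PowerSeries ℝ) * Y * (d⁄dX ℝ F * F⁻¹) := by
    have hs : (s : PowerSeries ℝ) = C (s : ℝ) := by simp
    rw [hYdef, derivative_subst hsL, derivative_exp, Derivation.map_smul, hL, hs, ← hYdef,
      smul_eq_C_mul]
    ring
  have hY0 : constantCoeff Y = 1 := by
    rw [← coeff_zero_eq_constantCoeff_apply, hYdef,
      coeff_subst_eq_sum (by simp [hL0]) _ le_rfl]
    simp
  have hYF : Y = C ((constantCoeff F)⁻¹ ^ s) * F ^ s := by
    -- Y and F^s have the same logarithmic derivative, so their quotient is constant.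
    have h1 : Y * F⁻¹ ^ s = C ((constantCoeff F)⁻¹ ^ s) := by
      apply derivative.ext
      · rw [derivative_C, Derivation.leibniz, PowerSeries.derivative_pow, derivative_inv', hdY]
        simp only [smul_eq_mul]
        rcases s with _ | s
        · simp
        · rw [Nat.add_sub_cancel]
          ring
      · simp [hY0]
    rw [← h1, mul_assoc, ← mul_pow, mul_comm F⁻¹, hFi, one_pow, mul_one]
  have h := coeff_succ_eq_coeff_derivative_subst hV n ((exp ℝ).subst ((s : ℝ) • ℓ))
  rw [hYT, hdY] at h
  have h2 : (s : PowerSeries ℝ) * Y * (d⁄dX ℝ F * F⁻¹) * V ^ (n + 1) =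
      C ((s : ℝ) * (constantCoeff F)⁻¹ ^ s) * (F ^ s * d⁄dX ℝ F * F⁻¹ * V ^ (n + 1)) := by
    have hs : (s : PowerSeries ℝ) = C (s : ℝ) := by simp
    rw [hYF, hs, map_mul]
    ring
  rw [h2, coeff_C_mul] at h
  rw [completeBell_eq_coeff_exp (Nat.succ_ne_zero n), hgen, Nat.factorial_succ]
  push_cast
  linear_combination (n.factorial : ℝ) * h

/-! ### The series e^{aφ} and P = φ/X. -/

open PowerSeries in
/-- The series `exp (a φ)`, for `φ` the exponential generating function of `x`. -/
noncomputable def expMul (x : ℕ → ℝ) (a : ℝ) : PowerSeries ℝ := (rescale a (exp ℝ)).subst (expGen x)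

open PowerSeries in
theorem hasSubst_expGen (x : ℕ → ℝ) : HasSubst (expGen x) :=
  HasSubst.of_constantCoeff_zero' (constantCoeff_expGen x)

theorem expMul_add (x : ℕ → ℝ) (a b : ℝ) : expMul x (a + b) = expMul x a * expMul x b := by
  rw [expMul, ← PowerSeries.exp_mul_exp_eq_exp_add, PowerSeries.subst_mul (hasSubst_expGen x)]
  rfl

open PowerSeries in
theorem expMul_zero (x : ℕ → ℝ) : expMul x 0 = 1 := by
  ext n
  rw [expMul, coeff_subst_eq_sum (constantCoeff_expGen x) _ le_rfl, sum_range_succ']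
  simp

theorem expMul_pow (x : ℕ → ℝ) (a : ℝ) (n : ℕ) : expMul x a ^ n = expMul x (n * a) := by
  induction n with
  | zero => simp [expMul_zero]
  | succ n ih => rw [pow_succ, ih, ← expMul_add]; push_cast; ring_nf

open PowerSeries in
theorem constantCoeff_expMul (x : ℕ → ℝ) (a : ℝ) : constantCoeff (expMul x a) = 1 := by
  rw [← coeff_zero_eq_constantCoeff_apply, expMul,
    coeff_subst_eq_sum (constantCoeff_expGen x) _ le_rfl]
  simp

open PowerSeries in
theorem derivative_expMul (x : ℕ → ℝ) (a : ℝ) :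
    d⁄dX ℝ (expMul x a) = C a * (expMul x a * d⁄dX ℝ (expGen x)) := by
  have h : d⁄dX ℝ (rescale a (exp ℝ)) = a • rescale a (exp ℝ) := by
    ext n
    have := congrArg (coeff n) (derivative_exp ℝ)
    rw [coeff_derivative] at this
    rw [coeff_derivative, coeff_rescale, coeff_smul, coeff_rescale, ← this, smul_eq_mul]
    ring
  rw [expMul, derivative_subst (hasSubst_expGen x), h, subst_smul (hasSubst_expGen x),
    smul_eq_C_mul]
  ring

/-- The quotient of the exponential generating function of `x` by the variable. -/
noncomputable def expGenDivX (x : ℕ → ℝ) : PowerSeries ℝ :=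
  PowerSeries.mk fun m => x (m + 1) / ((m + 1).factorial : ℝ)

open PowerSeries in
theorem expGen_eq_X_mul (x : ℕ → ℝ) : expGen x = X * expGenDivX x := by
  ext m
  rcases m with _ | m
  · simp [constantCoeff_expGen]
  · rw [coeff_succ_X_mul, expGen, expGenDivX, coeff_mk, coeff_mk, if_neg (Nat.succ_ne_zero m)]

open PowerSeries in
theorem constantCoeff_expGenDivX (x : ℕ → ℝ) : constantCoeff (expGenDivX x) = x 1 := by
  rw [← coeff_zero_eq_constantCoeff_apply, expGenDivX, coeff_mk]
  simp

open PowerSeries in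
theorem partialBell_add_add (x : ℕ → ℝ) (R n j : ℕ) :
    partialBell (R + n) (R + j) x = ((R + n).factorial : ℝ) / ((R + j).factorial : ℝ) *
      coeff n (expGen x ^ j * expGenDivX x ^ R) := by
  have h : expGen x ^ (R + j) = X ^ R * (expGen x ^ j * expGenDivX x ^ R) := by
    rw [pow_add]
    nth_rw 1 [expGen_eq_X_mul x]
    ring
  rw [partialBell, h, coeff_X_pow_mul', if_pos (Nat.le_add_right R n), Nat.add_sub_cancel_left]
  ring

-- Apply X d/dX to φ^j P^{Q+1} = X^j P^{Q+1+j}: on coefficients it multiplies by the degree, and on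
-- the product it differentiates X^j and the power of P separately.
open PowerSeries in
theorem coeff_pow_mul_derivative_expGenDivX (x : ℕ → ℝ) (Q j m : ℕ) :
    ((Q : ℝ) + 1 + j) *
        coeff m (expGen x ^ j * (expGenDivX x ^ Q * d⁄dX ℝ (expGenDivX x))) =
      ((m : ℝ) + 1 - j) * coeff (m + 1) (expGen x ^ j * expGenDivX x ^ (Q + 1)) := by
  have hd : X * d⁄dX ℝ (expGen x ^ j * expGenDivX x ^ (Q + 1)) =
      C (j : ℝ) * (expGen x ^ j * expGenDivX x ^ (Q + 1)) +
      C ((Q : ℝ) + 1 + j) *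
        (X * (expGen x ^ j * (expGenDivX x ^ Q * d⁄dX ℝ (expGenDivX x)))) := by
    rw [Derivation.leibniz, PowerSeries.derivative_pow, PowerSeries.derivative_pow,
      expGen_eq_X_mul x, Derivation.leibniz]
    simp only [smul_eq_mul, derivative_X, map_add, map_natCast, map_one, Nat.cast_add,
      Nat.cast_one, Nat.add_sub_cancel]
    rcases j with _ | j
    · simp
      ring
    · rw [Nat.add_sub_cancel]
      push_cast
      ring
  have h := congrArg (coeff (m + 1)) hd
  rw [coeff_succ_X_mul, coeff_derivative, map_add, coeff_C_mul, coeff_C_mul,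
    coeff_succ_X_mul] at h
  linear_combination -h

-- Since φ' = P + X P', this reduces to the previous identity with j + 1 in place of j.
open PowerSeries in
theorem coeff_pow_mul_derivative_expGen (x : ℕ → ℝ) (Q j m : ℕ) :
    ((Q : ℝ) + 1 + (j + 1)) *
        coeff m (expGen x ^ j * (expGenDivX x ^ (Q + 1) * d⁄dX ℝ (expGen x))) =
      ((Q : ℝ) + 1 + (m + 1)) *
        coeff (m + 1) (expGen x ^ (j + 1) * expGenDivX x ^ (Q + 1)) := by
  have hd : X * (expGen x ^ j * (expGenDivX x ^ (Q + 1) * d⁄dX ℝ (expGen x))) =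
      expGen x ^ (j + 1) * expGenDivX x ^ (Q + 1) +
        X * (expGen x ^ (j + 1) * (expGenDivX x ^ Q * d⁄dX ℝ (expGenDivX x))) := by
    have h : d⁄dX ℝ (expGen x) = X * d⁄dX ℝ (expGenDivX x) + expGenDivX x := by
      rw [expGen_eq_X_mul x, Derivation.leibniz]
      simp
    rw [h, expGen_eq_X_mul x]
    ring
  have h := congrArg (coeff (m + 1)) hd
  rw [map_add, coeff_succ_X_mul, coeff_succ_X_mul] at h
  have h' := coeff_pow_mul_derivative_expGenDivX x Q (j + 1) m
  push_cast at h'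
  rw [h]
  linear_combination h'

/-! ### The explicit sum as a coefficient. -/

-- F^s V^n = e^{wφ} P^R with n = m + 1 and w = cn + bs. Expanding e^{wφ} in powers of φ leaves
-- coefficients of φ^j P^R, which are partial Bell polynomials up to factorials.
open PowerSeries in
theorem bellZ_eq_coeff {x : ℕ → ℝ} (hx : x 1 ≠ 0) {r : ℕ} (hr : 1 ≤ r) (b c : ℝ) (m s : ℕ) :
    bellZ x (x 1) r b c (m + 1) s = (x 1)⁻¹ ^ s * ((m.factorial : ℝ) *
      coeff m ((expMul x b * expGenDivX x) ^ s * d⁄dX ℝ (expMul x b * expGenDivX x) *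
        (expMul x b * expGenDivX x)⁻¹ * (expMul x c * expGenDivX x ^ r) ^ (m + 1))) := by
  -- R is positive even for s = 0 because r ≥ 1, so R - 1 = Q is not truncated.
  obtain ⟨Q, hQ⟩ : ∃ Q, (m + 1) * r + s = Q + 1 :=
    ⟨(m + 1) * r + s - 1, by have := Nat.mul_le_mul (Nat.le_add_left 1 m) hr; omega⟩
  have hQ' : ((m : ℝ) + 1) * r + s = Q + 1 := by exact_mod_cast hQ
  set w : ℝ := c * (m + 1 : ℕ) + b * s with hw
  set P := expGenDivX x with hP
  have hP0 : constantCoeff P ≠ 0 := by rwa [hP, constantCoeff_expGenDivX]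
  set F := expMul x b * P with hFdef
  have hF0 : constantCoeff F ≠ 0 := by
    rwa [hFdef, map_mul, constantCoeff_expMul, one_mul]
  have hFi : F * F⁻¹ = 1 := PowerSeries.mul_inv_cancel F hF0
  have hprod : F ^ s * (expMul x c * P ^ r) ^ (m + 1) = expMul x w * P ^ (Q + 1) := by
    rw [hFdef, mul_pow, mul_pow, expMul_pow, expMul_pow, ← pow_mul, ← hQ, hw, pow_add,
      mul_comm r, add_comm (c * _), mul_comm c, mul_comm b, expMul_add]
    ring
  have hdF : d⁄dX ℝ F = expMul x b * (C b * (P * d⁄dX ℝ (expGen x)) + d⁄dX ℝ P) := by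
    rw [hFdef, Derivation.leibniz, derivative_expMul]
    simp only [smul_eq_mul]
    ring
  have hser : F ^ s * d⁄dX ℝ F * F⁻¹ * (expMul x c * P ^ r) ^ (m + 1) =
      expMul x w * (C b * (P ^ (Q + 1) * d⁄dX ℝ (expGen x)) + P ^ Q * d⁄dX ℝ P) := by
    -- Multiplying by F avoids the exponent s - 1, which would fail at s = 0.
    have hFne : F ≠ 0 := fun h => hF0 (by rw [h, map_zero])
    apply mul_right_cancel₀ hFne
    calc _ = (F ^ s * (expMul x c * P ^ r) ^ (m + 1)) * d⁄dX ℝ F * (F * F⁻¹) := by ring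
      _ = _ := by
        rw [hFi, hprod, hdF, hFdef]
        ring
  rw [hser]
  set p : ℕ → ℝ := fun j => coeff (m + 1) (expGen x ^ j * P ^ (Q + 1)) with hp
  have hcoeff : coeff m (expMul x w * (C b * (P ^ (Q + 1) * d⁄dX ℝ (expGen x)) + P ^ Q * d⁄dX ℝ P)) =
      ∑ j ∈ range (m + 1), w ^ j / (j.factorial : ℝ) *
        (b * (((Q : ℝ) + 1 + (m + 1)) / ((Q : ℝ) + 1 + (j + 1)) * p (j + 1)) +
          ((m : ℝ) + 1 - j) / ((Q : ℝ) + 1 + j) * p j) := by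
    rw [expMul, coeff_subst_mul_eq_sum (constantCoeff_expGen x)]
    refine sum_congr rfl fun j _ => ?_
    have h1 := coeff_pow_mul_derivative_expGen x Q j m
    have h2 := coeff_pow_mul_derivative_expGenDivX x Q j m
    have h3 : expGen x ^ j * (C b * (P ^ (Q + 1) * d⁄dX ℝ (expGen x)) + P ^ Q * d⁄dX ℝ P) =
        C b * (expGen x ^ j * (P ^ (Q + 1) * d⁄dX ℝ (expGen x))) +
          expGen x ^ j * (P ^ Q * d⁄dX ℝ P) := by ring
    rw [h3, map_add, coeff_C_mul, div_mul_eq_mul_div (_ + _ : ℝ), hp, hP]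
    dsimp only
    rw [← h1, mul_div_cancel_left₀ _ (by positivity), div_mul_eq_mul_div (_ - _ : ℝ), ← h2,
      mul_div_cancel_left₀ _ (by positivity)]
    simp [coeff_rescale, div_eq_mul_inv]
  have hbell : bellZ x (x 1) r b c (m + 1) s = (x 1)⁻¹ ^ s * (((m + 1).factorial : ℝ) *
      ∑ j ∈ range (m + 2), (if j = 0 then 1 else
        w ^ (j - 1) * ((((r : ℝ) + 1) * b - c) * j + w)) /
          ((j.factorial : ℝ) * ((Q : ℝ) + 1 + j)) * p j) := by
    rw [bellZ]
    simp only [hQ, ← hw, partialBell_add_add]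
    rw [mul_sum, mul_sum, mul_sum]
    refine sum_congr rfl fun j _ => ?_
    generalize (if j = 0 then (1 : ℝ) else _) = t
    have h1 : ((Q + j).choose Q : ℝ) = (Q + j).factorial / (Q.factorial * j.factorial) :=
      Nat.cast_add_choose ℝ
    have h2 : ((Q + 1 + (m + 1)).choose (m + 1) : ℝ) =
        (Q + 1 + (m + 1)).factorial / ((Q + 1).factorial * (m + 1).factorial) := by
      rw [← Nat.cast_add_choose ℝ, Nat.choose_symm_add]
    have h3 : ((Q + 1 + j).factorial : ℝ) = ((Q : ℝ) + 1 + j) * (Q + j).factorial := by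
      rw [show Q + 1 + j = Q + j + 1 by ring, Nat.factorial_succ]
      push_cast
      ring
    have h4 : ((Q + 1).factorial : ℝ) = ((Q : ℝ) + 1) * Q.factorial := by
      rw [Nat.factorial_succ]
      push_cast
      ring
    rw [show Q + 1 + j - 1 = Q + j by omega, Nat.add_sub_cancel, h1, h2, h3, h4, hp, ← hP, one_div, ← inv_pow]
    have h5 : ((Q + 1 + (m + 1)).factorial : ℝ) ≠ 0 := by positivity
    have h6 : ((Q + j).factorial : ℝ) ≠ 0 := by positivity
    generalize (x 1)⁻¹ ^ s = e
    push_cast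
    field_simp
  have hsum : ∑ j ∈ range (m + 1), w ^ j / (j.factorial : ℝ) *
        (b * (((Q : ℝ) + 1 + (m + 1)) / ((Q : ℝ) + 1 + (j + 1)) * p (j + 1)) +
          ((m : ℝ) + 1 - j) / ((Q : ℝ) + 1 + j) * p j) =
      ((m : ℝ) + 1) * ∑ j ∈ range (m + 2), (if j = 0 then 1 else
        w ^ (j - 1) * ((((r : ℝ) + 1) * b - c) * j + w)) /
          ((j.factorial : ℝ) * ((Q : ℝ) + 1 + j)) * p j := by
    -- The added term j = m + 1 carries the factor m + 1 - j = 0.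
    have hext : ∑ j ∈ range (m + 1), w ^ j / (j.factorial : ℝ) *
          (((m : ℝ) + 1 - j) / ((Q : ℝ) + 1 + j) * p j) =
        ∑ j ∈ range (m + 2), w ^ j / (j.factorial : ℝ) *
          (((m : ℝ) + 1 - j) / ((Q : ℝ) + 1 + j) * p j) := by
      rw [sum_range_succ _ (m + 1)]
      simp
    simp only [mul_add (_ / _ : ℝ), sum_add_distrib]
    rw [hext, sum_range_succ' _ (m + 1), sum_range_succ' _ (m + 1), ← add_assoc,
      ← sum_add_distrib, mul_add, mul_sum]
    congr 1
    · refine sum_congr rfl fun j _ => ?_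
      rw [if_neg (Nat.succ_ne_zero j), Nat.add_sub_cancel, Nat.factorial_succ, pow_succ]
      -- Two contributions meet at index j + 1, from φ' and from P'; substituting R = nr + s and w =
      -- cn + bs turns them into n times the factor in braces.
      have hrel : b * ((Q : ℝ) + 1 + (m + 1)) * (j + 1) + (m - j) * w =
          (m + 1) * ((((r : ℝ) + 1) * b - c) * (j + 1) + w) := by
        rw [← hQ', hw]
        push_cast
        ring
      have h1 : (j.factorial : ℝ) ≠ 0 := by positivity
      have h2 : (Q : ℝ) + 1 + (j + 1) ≠ 0 := by positivity
      have h3 : (j : ℝ) + 1 ≠ 0 := by positivity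
      push_cast
      field_simp
      linear_combination (w ^ j * p (j + 1)) * hrel
    · simp
      ring
  rw [hbell, hcoeff, hsum, Nat.factorial_succ]
  push_cast
  ring

theorem bellZPow_eq_bellZ (x : ℕ → ℝ) (d : ℝ) (r : ℕ) (y : ℝ) (n s : ℕ) :
    bellZPow x d r y n s = bellZ x d r y (((r : ℝ) + 1) * y) n s := by
  rw [bellZPow, bellZ]
  congr 1
  refine sum_congr rfl fun j _ => ?_
  rw [mul_assoc]
  congr 1
  rcases j with _ | j
  · simp
  · rw [if_neg (Nat.succ_ne_zero j), Nat.add_sub_cancel, sub_self, zero_mul, zero_add, ← pow_succ,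
      ← mul_pow]
    push_cast
    ring

open PowerSeries in
theorem satisfiesCompleteBellEq_bellZ {x : ℕ → ℝ} (hx : x 1 ≠ 0) {r : ℕ} (hr : 1 ≤ r)
    (b c : ℝ) : SatisfiesCompleteBellEq (bellZ x (x 1) r b c) := by
  intro n s hn
  obtain ⟨m, rfl⟩ := Nat.exists_eq_add_of_le' hn
  have hF : constantCoeff (expMul x b * expGenDivX x) = x 1 := by
    rw [map_mul, constantCoeff_expMul, one_mul, constantCoeff_expGenDivX]
  have hV : constantCoeff (expMul x c * expGenDivX x ^ r) ≠ 0 := by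
    rw [map_mul, constantCoeff_expMul, one_mul, map_pow, constantCoeff_expGenDivX]
    exact pow_ne_zero r hx
  rw [completeBell_lagrange (hF.trans_ne hx) hV s m fun k => ?_, bellZ_eq_coeff hx hr, hF]
  -- The arguments Z(k,0) are the s = 0 case of the same coefficient formula.
  rw [bellZ_eq_coeff hx hr, pow_zero, pow_zero, one_mul, one_mul]

/-! ### Existence of the binomial sequence. -/

/-- The polynomial `∑_k B_{n,k}(x_1, x_2, …) u^k` in the variable `u`. -/
noncomputable def bellPolynomial (x : ℕ → ℝ) (n : ℕ) : Polynomial ℝ :=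
  ∑ k ∈ range (n + 1), Polynomial.C (partialBell n k x) * Polynomial.X ^ k

theorem coeff_bellPolynomial (x : ℕ → ℝ) {n k : ℕ} (h : k ≤ n) :
    (bellPolynomial x n).coeff k = partialBell n k x := by
  simp [bellPolynomial, Polynomial.finsetSum_coeff, Polynomial.coeff_X_pow, h]

theorem eval_bellPolynomial (x : ℕ → ℝ) (n : ℕ) (u : ℝ) :
    (bellPolynomial x n).eval u = (n.factorial : ℝ) * PowerSeries.coeff n (expMul x u) := by
  rw [expMul, coeff_subst_eq_sum (constantCoeff_expGen x) _ le_rfl, bellPolynomial,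
    Polynomial.eval_finsetSum, mul_sum]
  refine sum_congr rfl fun k _ => ?_
  simp [partialBell, PowerSeries.coeff_rescale]
  ring

theorem partialBell_self (x : ℕ → ℝ) (n : ℕ) : partialBell n n x = x 1 ^ n := by
  have h := partialBell_add_add x n 0 0
  rw [Nat.add_zero] at h
  have h1 : (n.factorial : ℝ) ≠ 0 := by positivity
  rw [h, div_self h1]
  simp [constantCoeff_expGenDivX]

theorem isBinomialType_bellPolynomial {x : ℕ → ℝ} (hx : x 1 ≠ 0) :
    IsBinomialType (bellPolynomial x) where
  zero := by simp [bellPolynomial, partialBell_self]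
  natDegree_eq n := by
    refine Polynomial.natDegree_eq_of_le_of_coeff_ne_zero ?_ ?_
    · refine Polynomial.natDegree_sum_le_of_forall_le _ _ fun k hk => ?_
      exact (Polynomial.natDegree_C_mul_X_pow_le _ _).trans (Nat.lt_succ_iff.mp (mem_range.mp hk))
    · rw [coeff_bellPolynomial x le_rfl, partialBell_self]
      exact pow_ne_zero n hx
  eval_add n u v := by
    simp only [eval_bellPolynomial]
    rw [expMul_add, PowerSeries.coeff_mul, Nat.sum_antidiagonal_eq_sum_range_succ_mk, mul_sum]
    refine sum_congr rfl fun k hk => ?_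
    rw [← Nat.choose_mul_factorial_mul_factorial (Nat.lt_succ_iff.mp (mem_range.mp hk))]
    push_cast
    ring

theorem derivative_bellPolynomial_eval_zero (x : ℕ → ℝ) {n : ℕ} (hn : 1 ≤ n) :
    (Polynomial.derivative (bellPolynomial x n)).eval 0 = x n := by
  have h1 : (n.factorial : ℝ) ≠ 0 := by positivity
  rw [← Polynomial.coeff_zero_eq_eval_zero, Polynomial.coeff_derivative,
    zero_add, coeff_bellPolynomial x hn, partialBell, pow_one, expGen, PowerSeries.coeff_mk,
    if_neg (by omega)]
  simp
  field_simp

theorem mainTheorem8 (x : ℕ → ℝ) (hx : x 1 ≠ 0) :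
    (∃ f : ℕ → Polynomial ℝ, IsBinomialType f ∧
      ∀ n : ℕ, 1 ≤ n → (Polynomial.derivative (f n)).eval 0 = x n) ∧
    ∀ f : ℕ → Polynomial ℝ, IsBinomialType f →
      (∀ n : ℕ, 1 ≤ n → (Polynomial.derivative (f n)).eval 0 = x n) →
      ∀ r : ℕ, 1 ≤ r →
        (∀ b c : ℝ, SatisfiesCompleteBellEq
          (bellZ x ((Polynomial.derivative (f 1)).eval 0) r b c)) ∧
        (∀ y : ℝ, SatisfiesCompleteBellEq
          (bellZPow x ((Polynomial.derivative (f 1)).eval 0) r y)) := by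
  refine ⟨⟨bellPolynomial x, isBinomialType_bellPolynomial hx,
    fun n hn => derivative_bellPolynomial_eval_zero x hn⟩, fun f _ hf r hr => ?_⟩
  rw [hf 1 le_rfl]
  refine ⟨satisfiesCompleteBellEq_bellZ hx hr, fun y => ?_⟩
  rw [show bellZPow x (x 1) r y = bellZ x (x 1) r y (((r : ℝ) + 1) * y) from
    funext₂ (bellZPow_eq_bellZ x (x 1) r y)]
  exact satisfiesCompleteBellEq_bellZ hx hr _ _
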